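/- Let $K$ be a field. Let $\Gamma=(\Gamma_0,\Gamma_1,\mu,\mathfrak o)$ be a Brauer configuration: $\Gamma_0$ is a finite set of vertices; $\Gamma_1$ is a finite collection of labeled finite multisets of vertices, called polygons; $\mu:\Gamma_0\to\mathbb Z_{>0}$ is a function. Write $\mathrm{occ}(\alpha,V)$ for the multiplicity of $\alpha$ in $V$, $\mathrm{val}(\alpha)=\sum_{V\in\Gamma_1}\mathrm{occ}(\alpha,V)$, and $\overline V$ for the set of vertices occurring in $V$; call $\alpha$ truncated if $\mathrm{val}(\alpha)=\mu(\alpha)=1$. The orientation $\mathfrak o$ chooses for every nontruncated vertex $\alpha$ a cyclic ordering $V_1<\dots<V_t<V_1$, $t=\mathrm{val}(\alpha)$, of the polygons containing $\alpha$, in which each $V$ is listed $\mathrm{occ}(\alpha,V)$ times. It is required that every vertex occurs in some polygon, that every polygon has at least two vertices (counted with multiplicity), and that every polygon contains a vertex $\alpha$ with $\mathrm{val}(\alpha)\mu(\alpha)>1$. Let $\mathcal Q$ be the quiver with one vertex $v$ for each polygon $V$ and, for each nontruncated $\alpha$ with cyclic ordering $V_1<\dots<V_t<V_1$, arrows $a^{(\alpha)}_l:v_l\to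 v_{l+1}$ for $1\le l\le t$ (where $v_{t+1}=v_1$). Paths are composed from left to right. The special $\alpha$-cycles are $C_l=a^{(\alpha)}_l\cdots a^{(\alpha)}_t a^{(\alpha)}_1\cdots a^{(\alpha)}_{l-1}$, $1\le l\le t$; $C_l$ is a special $\alpha$-cycle at $v_l$. The Brauer configuration algebra is $\Lambda=K\mathcal Q/I$, where $I$ is the two-sided ideal generated by 1. $C^{\mu(\alpha)}-D^{\mu(\beta)}$ for all nontruncated vertices $\alpha,\beta$ (possibly equal) and all special $\alpha$-cycles $C$ and special $\beta$-cycles $D$ at the same vertex of $\mathcal Q$; 2. $C^{\mu(\alpha)}a$ for all special $\alpha$-cycles $C$, where $a$ is the first arrow of $C$; 3. all paths $ab$ of length two that are not a subpath of any special cycle, except $ab=a^2$ where $a$ is the loop given by a nontruncated vertex of valency $1$. Then $\Lambda$ is a finite-dimensional basic $K$-algebra, the classes of the trivial paths $v$ ($V\in\Gamma_1$) form a complete set of primitive orthogonal idempotents of $\Lambda$, and the entries $c_{v,w}=\dim_K w\Lambda v$ of its Cartan matrix are $$c_{v,w}=\begin{cases}2+\sum\limits_{\alpha\in\overline V}\mathrm{occ}(\alpha,V)\bigl(\mathrm{occ}(\alpha,V)\mu(\alpha)-1\bigr),&V=W,\\[2mm]\sum\limits_{\alpha\in\overline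 V\cap\overline W}\mu(\alpha)\,\mathrm{occ}(\alpha,V)\,\mathrm{occ}(\alpha,W),&V\neq W.\end{cases}$$ -/

import Mathlib

noncomputable section

/-! # Path algebras -/

/-- The paths of a quiver `Q`, with arbitrary source and target. -/
abbrev QuiverPath (Q : Type*) [Quiver Q] := Σ i j : Q, Quiver.Path i j

/-- The path algebra `KQ`: the `K`-vector space with basis the paths of `Q`, multiplied by
concatenation (from left to right). -/
def PathAlgebra (K Q : Type*) [Field K] [Quiver Q] := QuiverPath Q →₀ K

namespace PathAlgebra

variable (K : Type*) {Q : Type*} [Field K] [Quiver Q]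

instance : AddCommGroup (PathAlgebra K Q) := inferInstanceAs (AddCommGroup (QuiverPath Q →₀ K))

instance : Module K (PathAlgebra K Q) := inferInstanceAs (Module K (QuiverPath Q →₀ K))

/-- The basis element of `KQ` given by a path. -/
def ofPath (p : QuiverPath Q) : PathAlgebra K Q := Finsupp.single p 1

/-- The linear map out of `KQ` with given values on paths. -/
def linearLift {M : Type*} [AddCommGroup M] [Module K M] (f : QuiverPath Q → M) :
    PathAlgebra K Q →ₗ[K] M :=
  (Finsupp.lift M K (QuiverPath Q) f : (QuiverPath Q →₀ K) →ₗ[K] M)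

lemma linearLift_ofPath {M : Type*} [AddCommGroup M] [Module K M] (f : QuiverPath Q → M)
    (p : QuiverPath Q) : linearLift K f (ofPath K p) = f p := by
  have h : (Finsupp.lift M K (QuiverPath Q) f) (Finsupp.single p 1) = f p := by simp
  exact h

open Classical in
/-- The product of two paths: their concatenation `pq` if `p` ends where `q` starts, and `0`
otherwise. -/
def mulPath (p q : QuiverPath Q) : PathAlgebra K Q :=
  if h : p.2.1 = q.1 then
    ofPath K ⟨p.1, q.2.1, p.2.2.comp (q.2.2.cast h.symm rfl)⟩
  else 0

/-- The multiplication of `KQ`, as a bilinear map. -/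
def mulLin : PathAlgebra K Q →ₗ[K] PathAlgebra K Q →ₗ[K] PathAlgebra K Q :=
  linearLift K fun p => linearLift K fun q => mulPath K p q

variable {K}

lemma mulLin_ofPath (p q : QuiverPath Q) :
    mulLin K (ofPath K p) (ofPath K q) = mulPath K p q := by
  rw [mulLin, linearLift_ofPath, linearLift_ofPath]

/-- Linear maps out of `KQ` are determined by their values on paths. -/
lemma hom_ext {M : Type*} [AddCommGroup M] [Module K M] {f g : PathAlgebra K Q →ₗ[K] M}
    (h : ∀ p, f (ofPath K p) = g (ofPath K p)) : f = g :=
  Finsupp.lhom_ext' fun p => LinearMap.ext_ring (h p)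

lemma mulPath_comp {i j k : Q} (p : Quiver.Path i j) (q : Quiver.Path j k) :
    mulPath K ⟨i, j, p⟩ ⟨j, k, q⟩ = ofPath K ⟨i, k, p.comp q⟩ := by
  simp [mulPath]

lemma mulPath_of_ne {p q : QuiverPath Q} (h : p.2.1 ≠ q.1) : mulPath K p q = 0 := by
  simp [mulPath, h]

lemma mulPath_assoc (p q r : QuiverPath Q) :
    mulLin K (mulPath K p q) (ofPath K r) = mulLin K (ofPath K p) (mulPath K q r) := by
  obtain ⟨a, b, p⟩ := p
  obtain ⟨c, d, q⟩ := q
  obtain ⟨e, f, r⟩ := r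
  by_cases h : b = c
  · subst h
    by_cases h' : d = e
    · subst h'
      simp [mulPath_comp, mulLin_ofPath, Quiver.Path.comp_assoc]
    · rw [mulPath_comp, mulLin_ofPath, mulPath_of_ne h', mulPath_of_ne h', map_zero]
  · rw [mulPath_of_ne h, map_zero, LinearMap.zero_apply]
    by_cases h' : d = e
    · subst h'
      rw [mulPath_comp, mulLin_ofPath, mulPath_of_ne h]
    · rw [mulPath_of_ne h', map_zero]

lemma mulLin_assoc (x y z : PathAlgebra K Q) :
    mulLin K (mulLin K x y) z = mulLin K x (mulLin K y z) := by
  have h : (mulLin K).compr₂ (mulLin (Q := Q) K) =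
      ((LinearMap.llcomp K (PathAlgebra K Q) (PathAlgebra K Q) (PathAlgebra K Q)).flip.comp
        (mulLin K)).flip.comp (mulLin K) := by
    refine hom_ext fun p => hom_ext fun q => hom_ext fun r => ?_
    simpa [mulLin_ofPath] using mulPath_assoc p q r
  simpa using congrArg (fun f => f x y z) h

variable [Fintype Q]

variable (K) in
/-- The trivial path at a vertex, as an element of `KQ`. -/
def vertex (i : Q) : PathAlgebra K Q := ofPath K ⟨i, i, Quiver.Path.nil⟩

lemma one_mulLin (x : PathAlgebra K Q) : mulLin K (∑ i, vertex K i) x = x := by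
  have h : mulLin K (∑ i : Q, vertex K i) = LinearMap.id := by
    refine hom_ext fun ⟨a, b, p⟩ => ?_
    rw [map_sum, LinearMap.sum_apply, Finset.sum_eq_single a]
    · simp [vertex, mulLin_ofPath, mulPath_comp]
    · intro c _ hc
      rw [vertex, mulLin_ofPath, mulPath_of_ne hc]
    · simp
  rw [h, LinearMap.id_apply]

lemma mulLin_one (x : PathAlgebra K Q) : mulLin K x (∑ i, vertex K i) = x := by
  have h : (mulLin K).flip (∑ i : Q, vertex K i) = LinearMap.id := by
    refine hom_ext fun ⟨a, b, p⟩ => ?_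
    rw [LinearMap.flip_apply, map_sum, Finset.sum_eq_single b]
    · simp [vertex, mulLin_ofPath, mulPath_comp]
    · intro c _ hc
      rw [vertex, mulLin_ofPath, mulPath_of_ne (Ne.symm hc)]
    · simp
  simpa using congrArg (fun f => f x) h

instance : Ring (PathAlgebra K Q) :=
  { (inferInstance : AddCommGroup (PathAlgebra K Q)) with
    mul := fun x y => mulLin K x y
    one := ∑ i, vertex K i
    mul_assoc := mulLin_assoc
    one_mul := one_mulLin
    mul_one := mulLin_one
    left_distrib := fun x y z => map_add (mulLin K x) y z
    right_distrib := fun x y z => LinearMap.map_add₂ (mulLin K) x y z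
    zero_mul := fun x => LinearMap.map_zero₂ (mulLin K) x
    mul_zero := fun x => map_zero (mulLin K x) }

instance : Algebra K (PathAlgebra K Q) :=
  Algebra.ofModule (fun c x y => LinearMap.map_smul₂ (mulLin K) c x y)
    (fun c x y => map_smul (mulLin K x) c y)

variable (K) in
/-- An arrow, as an element of `KQ`. -/
def arrow {i j : Q} (a : i ⟶ j) : PathAlgebra K Q := ofPath K ⟨i, j, a.toPath⟩

end PathAlgebra

/-! # Idempotents and Cartan matrices -/

/-- A primitive idempotent: a nonzero idempotent which is not the sum of two nonzero orthogonal
idempotents. -/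
def IsPrimitiveIdempotent {R : Type*} [Ring R] (e : R) : Prop :=
  IsIdempotentElem e ∧ e ≠ 0 ∧
    ∀ f g : R, IsIdempotentElem f → IsIdempotentElem g → f * g = 0 → g * f = 0 →
      e = f + g → f = 0 ∨ g = 0

/-- `e` is a complete set of primitive orthogonal idempotents of `R`, and `R` is basic: the right
modules `e i R` are pairwise nonisomorphic. -/
structure IsBasicIdempotentFamily {R ι : Type*} [Ring R] [Fintype ι] (e : ι → R) : Prop where
  complete : CompleteOrthogonalIdempotents e
  primitive : ∀ i, IsPrimitiveIdempotent (e i)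
  basic : ∀ i j, i ≠ j →
    IsEmpty (Submodule.span Rᵐᵒᵖ {e i} ≃ₗ[Rᵐᵒᵖ] Submodule.span Rᵐᵒᵖ {e j})

/-- The `K`-subspace `e R f` of a `K`-algebra `R`. -/
def peirceSpace (K : Type*) {R : Type*} [Field K] [Ring R] [Algebra K R] (e f : R) :
    Submodule K R :=
  LinearMap.range (LinearMap.mulLeft K e ∘ₗ LinearMap.mulRight K f)

/-- The Cartan matrix with respect to the idempotents `e i`: its `(i, j)` entry is
`dim_K (e j R e i)`. -/
def cartanMatrix (K : Type*) {R ι : Type*} [Field K] [Ring R] [Algebra K R] (e : ι → R) :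
    Matrix ι ι ℕ :=
  Matrix.of fun i j => Module.finrank K (peirceSpace K (e j) (e i))

/-! # Brauer configurations -/

/-- A Brauer configuration with vertices `Γ₀` and polygons labelled by `Γ₁`. The orientation is
given by a successor sequence `order α` at each vertex `α`, in which every polygon `V` occurs
as often as `α` occurs in `V`; it is read cyclically. (For a truncated vertex this list is forced
to consist of the only polygon containing the vertex, and it is not used.) -/
structure BrauerConfiguration (Γ₀ Γ₁ : Type*) [Fintype Γ₀] [Fintype Γ₁] [DecidableEq Γ₀]
    [DecidableEq Γ₁] where
  polygon : Γ₁ → Multiset Γ₀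
  mult : Γ₀ → ℕ
  mult_pos : ∀ α, 0 < mult α
  order : Γ₀ → List Γ₁
  count_order : ∀ α V, (order α).count V = (polygon V).count α
  exists_mem_polygon : ∀ α, ∃ V, α ∈ polygon V
  two_le_card : ∀ V, 2 ≤ (polygon V).card
  exists_one_lt : ∀ V, ∃ α ∈ polygon V, 1 < (∑ W, (polygon W).count α) * mult α

namespace BrauerConfiguration

variable {Γ₀ Γ₁ : Type*} [Fintype Γ₀] [Fintype Γ₁] [DecidableEq Γ₀] [DecidableEq Γ₁]
  (Γ : BrauerConfiguration Γ₀ Γ₁)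

/-- The number of times the vertex `α` occurs in the polygon `V`. -/
def occ (α : Γ₀) (V : Γ₁) : ℕ := (Γ.polygon V).count α

/-- The valency of a vertex. -/
def val (α : Γ₀) : ℕ := ∑ V, Γ.occ α V

/-- A vertex is truncated if its valency and its multiplicity are both `1`. -/
def IsTruncated (α : Γ₀) : Prop := Γ.val α = 1 ∧ Γ.mult α = 1

/-- The set of vertices occurring in a polygon. -/
def support (V : Γ₁) : Finset Γ₀ := (Γ.polygon V).toFinset

/-- The arrows of the induced quiver: one for each place in the successor sequence of each
nontruncated vertex. -/
def Arrow := Σ α : {α : Γ₀ // ¬ Γ.IsTruncated α}, Fin (Γ.order α).length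

variable {Γ}

/-- The vertex of the Brauer configuration from which an arrow of the quiver arises. -/
def Arrow.color (a : Γ.Arrow) : Γ₀ := a.1

/-- The arrow at the next place in the cyclic order. -/
def Arrow.next (a : Γ.Arrow) : Γ.Arrow := ⟨a.1, finRotate _ a.2⟩

/-- The polygon standing at the place of the arrow. -/
def Arrow.src (a : Γ.Arrow) : Γ₁ := (Γ.order a.1).get a.2

/-- The successor of `a.src` at this place of the cyclic order. -/
def Arrow.tgt (a : Γ.Arrow) : Γ₁ := a.next.src

/-- The special cycle with first arrow `a`, as the list of its arrows: starting at `a`, once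
around the cyclic order. -/
def Arrow.specialCycle (a : Γ.Arrow) : List Γ.Arrow :=
  (List.range (Γ.val a.color)).map fun n => Arrow.next^[n] a

variable (Γ)

/-- The vertices of the induced quiver, which correspond to the polygons. -/
def QuiverVertex (_ : BrauerConfiguration Γ₀ Γ₁) := Γ₁

instance : Fintype Γ.QuiverVertex := inferInstanceAs (Fintype Γ₁)

/-- The quiver induced by a Brauer configuration. -/
instance : Quiver Γ.QuiverVertex where
  Hom V W := {a : Γ.Arrow // a.src = V ∧ a.tgt = W}

variable (K : Type*) [Field K]

variable {Γ} in
/-- An arrow as an element of the path algebra. -/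
def Arrow.toPathAlgebra (a : Γ.Arrow) : PathAlgebra K Γ.QuiverVertex :=
  PathAlgebra.arrow K (i := a.src) (j := a.tgt) ⟨a, rfl, rfl⟩

variable {Γ} in
/-- The special cycle with first arrow `a`, as an element of the path algebra. -/
def Arrow.cycle (a : Γ.Arrow) : PathAlgebra K Γ.QuiverVertex :=
  (a.specialCycle.map (Arrow.toPathAlgebra K)).prod

/-- Relations of type one: `C ^ μ(α) - D ^ μ(β)` for special cycles `C`, `D` at the same `v`,
belonging to nontruncated vertices `α`, `β` (which may coincide). -/
def relationsOne : Set (PathAlgebra K Γ.QuiverVertex) :=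
  {x | ∃ a b : Γ.Arrow, a.src = b.src ∧
    x = a.cycle K ^ Γ.mult a.color - b.cycle K ^ Γ.mult b.color}

/-- Relations of type two: `C ^ μ(α) f(C)`, where `f(C)` is the first arrow of `C`. -/
def relationsTwo : Set (PathAlgebra K Γ.QuiverVertex) :=
  {x | ∃ a : Γ.Arrow, x = a.cycle K ^ Γ.mult a.color * a.toPathAlgebra K}

/-- Relations of type three: the paths `ab` of length two which are not subpaths of any special
cycle, unless `a = b` is the loop given by a nontruncated vertex of valency `1`. -/
def relationsThree : Set (PathAlgebra K Γ.QuiverVertex) :=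
  {x | ∃ a b : Γ.Arrow, a.tgt = b.src ∧ (∀ c : Γ.Arrow, ¬ [a, b] <:+: c.specialCycle) ∧
    ¬ (a = b ∧ Γ.val a.color = 1) ∧ x = a.toPathAlgebra K * b.toPathAlgebra K}

/-- The ideal generated by the relations. -/
def relationIdeal : TwoSidedIdeal (PathAlgebra K Γ.QuiverVertex) :=
  TwoSidedIdeal.span (Γ.relationsOne K ∪ Γ.relationsTwo K ∪ Γ.relationsThree K)

/-- The Brauer configuration algebra `KQ/I`. -/
abbrev BrauerAlgebra := (Γ.relationIdeal K).ringCon.Quotient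

/-- The idempotent of the Brauer configuration algebra given by the vertex of the quiver
associated to a polygon. -/
def idempotent (V : Γ₁) : Γ.BrauerAlgebra K :=
  (Γ.relationIdeal K).ringCon.mk' (PathAlgebra.vertex K (Q := Γ.QuiverVertex) V)

end BrauerConfiguration

end

/-!
The Brauer configuration algebra `Λ` has an explicit basis consisting of classes of paths. Write
`L(a) = val(α) μ(α)` for an arrow `a` arising from the vertex `α`, so that `C ^ μ(α)` has length
`L(a)` if `C` is the special cycle with first arrow `a`, and let `next a` be the arrow following `a`
in the cyclic order. The basis consists of

* the trivial paths,
* the paths `a, next a, next (next a), …` of length `n` with `1 ≤ n < L(a)`, for all arrows `a`,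
* one socle element `C ^ μ(α)` at each vertex of the quiver; by the relations of type one its class
  does not depend on the choice of the special cycle.

*Spanning.* The relations of type three are exactly the paths `ab` with `b ≠ next a`. Hence a
path which is not a walk along a cyclic order is zero in `Λ`, and by the relations of type two so
is a walk longer than `L(a)` (`proj_ofPath_eq`).

*Independence.* Sending each path to its normal form, a basis index or zero, defines a linear map
`normalForm` on the path algebra. It vanishes on `x * r * y` for all paths `x`, `y` and all
generators `r` of the relation ideal: a walk containing some `C ^ μ(α)` and anything else is too
long, so both terms of a relation of type one go to zero unless `x` and `y` are trivial, and then
both go to the same socle index or both to zero (`normalForm_eq_zero`).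

*Idempotents.* The span of the classes of nontrivial paths is a nilpotent ideal, because long paths
vanish; hence it contains no nonzero idempotent, and in particular no `e_V`. Since `e_V Λ e_V` is
`K e_V` modulo this ideal, `e_V` is primitive; since `e_V Λ e_W` lies in the ideal for `V ≠ W`, the
modules `e_V Λ` and `e_W Λ` are not isomorphic.

*Cartan matrix.* Multiplication by `e_W` from the left and `e_V` from the right fixes or kills every
basis vector, so the entry is the number of basis paths from `W` to `V`
(`LinearMap.finrank_range_eq_card`). The walks of length `0 ≤ n < L(a)` starting with `a` run `μ(α)`
times around the cyclic order and hence end `μ(α) occ(α, V)` times at `V`; subtracting those of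
length zero gives the formula (`midCount_add`).
-/

noncomputable section

namespace BrauerConfiguration

variable {Γ₀ Γ₁ : Type*} [Fintype Γ₀] [Fintype Γ₁] [DecidableEq Γ₀] [DecidableEq Γ₁]
  {Γ : BrauerConfiguration Γ₀ Γ₁}

/-! ### The cyclic orders and the words running around them -/

lemma length_order (Γ : BrauerConfiguration Γ₀ Γ₁) (α : Γ₀) :
    (Γ.order α).length = Γ.val α := by
  have h := Multiset.sum_count_eq_card (s := Finset.univ) (m := (Γ.order α : Multiset Γ₁))
    fun a _ => Finset.mem_univ a
  simp only [Multiset.coe_count, Multiset.coe_card, Γ.count_order] at h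
  exact h.symm

lemma val_pos (Γ : BrauerConfiguration Γ₀ Γ₁) (α : Γ₀) : 0 < Γ.val α := by
  obtain ⟨V, hV⟩ := Γ.exists_mem_polygon α
  exact (Multiset.count_pos.2 hV).trans_le
    (Finset.single_le_sum (f := Γ.occ α) (fun _ _ => Nat.zero_le _) (Finset.mem_univ V))

lemma val_finRotate_iterate {n : ℕ} (i : Fin n) (k : ℕ) :
    (((finRotate n)^[k] i : Fin n) : ℕ) = (i + k) % n := by
  obtain _ | n := n
  · exact i.elim0
  induction k with
  | zero => simp [Nat.mod_eq_of_lt i.2]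
  | succ k ih =>
    rw [Function.iterate_succ_apply', finRotate_apply, Fin.val_add, ih]
    simp [add_assoc]

namespace Arrow

/-- The number of arrows in `C ^ μ(α)`, where `C` is the special `α`-cycle with first arrow `a`. -/
def socleLength (a : Γ.Arrow) : ℕ := Γ.val a.color * Γ.mult a.color

lemma socleLength_eq {a b : Γ.Arrow} (h : a.color = b.color) : a.socleLength = b.socleLength := by
  rw [socleLength, socleLength, h]

lemma one_lt_socleLength (a : Γ.Arrow) : 1 < a.socleLength := by
  have h1 := Γ.val_pos a.color
  have h2 := Γ.mult_pos a.color
  have h3 : ¬ (Γ.val a.color = 1 ∧ Γ.mult a.color = 1) := a.1.2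
  have h4 : 0 < a.socleLength := Nat.mul_pos h1 h2
  have h5 : a.socleLength ≠ 1 := fun h => h3 (mul_eq_one.1 h)
  omega

lemma next_iterate (a : Γ.Arrow) (n : ℕ) :
    next^[n] a = ⟨a.1, (finRotate _)^[n] a.2⟩ := by
  induction n with
  | zero => rfl
  | succ n ih => rw [Function.iterate_succ_apply', ih, Function.iterate_succ_apply']; rfl

lemma next_iterate_val (a : Γ.Arrow) : next^[Γ.val a.color] a = a := by
  rw [next_iterate]
  have h : (finRotate _)^[Γ.val a.color] a.2 = a.2 := by
    ext
    rw [val_finRotate_iterate, ← length_order]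
    exact (Nat.add_mod_right _ _).trans (Nat.mod_eq_of_lt a.2.2)
  rw [h]
  rfl

lemma next_iterate_val_mul (a : Γ.Arrow) (m : ℕ) : next^[Γ.val a.color * m] a = a := by
  rw [Function.iterate_mul]
  exact Function.iterate_fixed a.next_iterate_val m

lemma next_iterate_socleLength (a : Γ.Arrow) : next^[a.socleLength] a = a :=
  a.next_iterate_val_mul _

/-- The word consisting of the arrow `a` and its successors in the cyclic order, `n` arrows in
all; it may run around the cycle several times. -/
def walk (a : Γ.Arrow) (n : ℕ) : List Γ.Arrow := (List.range n).map fun k => next^[k] a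

lemma specialCycle_eq_walk (a : Γ.Arrow) : a.specialCycle = a.walk (Γ.val a.color) := rfl

@[simp] lemma length_walk (a : Γ.Arrow) (n : ℕ) : (a.walk n).length = n := by simp [walk]

lemma walk_add (a : Γ.Arrow) (m n : ℕ) : a.walk (m + n) = a.walk m ++ (next^[m] a).walk n := by
  simp only [walk, List.range_add, List.map_append, List.map_map]
  congr 1
  refine List.map_congr_left fun k _ => ?_
  simp [add_comm m k, Function.iterate_add_apply]

lemma walk_one (a : Γ.Arrow) : a.walk 1 = [a] := rfl

lemma walk_succ (a : Γ.Arrow) (n : ℕ) : a.walk (n + 1) = a.walk n ++ [next^[n] a] := by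
  rw [walk_add, walk_one]

lemma walk_succ' (a : Γ.Arrow) (n : ℕ) : a.walk (n + 1) = a :: a.next.walk n := by
  rw [add_comm, walk_add, walk_one]; rfl

/-- A word is a chain if every arrow is followed by its successor in the cyclic order. -/
abbrev _root_.BrauerConfiguration.IsSuccChain (l : List Γ.Arrow) : Prop :=
  l.IsChain fun a b => b = a.next

lemma isSuccChain_walk (a : Γ.Arrow) (n : ℕ) : IsSuccChain (a.walk n) := by
  induction n generalizing a with
  | zero => exact .nil
  | succ n ih =>
    rw [walk_succ']
    have := ih a.next
    cases n with
    | zero => exact .singleton _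
    | succ n =>
      rw [walk_succ'] at this ⊢
      exact .cons_cons rfl this

lemma eq_walk_of_isSuccChain {a : Γ.Arrow} {l : List Γ.Arrow} (h : IsSuccChain (a :: l)) :
    a :: l = a.walk (l.length + 1) := by
  induction l generalizing a with
  | nil => rfl
  | cons b l ih =>
    rw [IsSuccChain, List.isChain_cons_cons] at h
    obtain ⟨rfl, h⟩ := h
    rw [List.length_cons, walk_succ', ← ih h]

lemma color_of_mem_walk {a b : Γ.Arrow} {n : ℕ} (h : b ∈ a.walk n) : b.color = a.color := by
  rw [walk, List.mem_map] at h
  obtain ⟨k, -, rfl⟩ := h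
  rw [next_iterate]; rfl

lemma color_eq_of_isSuccChain {l : List Γ.Arrow} (h : IsSuccChain l) {a b : Γ.Arrow}
    (ha : a ∈ l) (hb : b ∈ l) : a.color = b.color := by
  cases l with
  | nil => simp at ha
  | cons c l =>
    rw [eq_walk_of_isSuccChain h] at ha hb
    rw [color_of_mem_walk ha, color_of_mem_walk hb]

/-- Together with `infix_specialCycle` and `next_eq_self` this shows that the relations of type
three concern exactly the paths `ab` in which `b` is not the successor of `a`. At valency `1` the
successor of the loop `a` is `a` itself, and although the special cycle `a` is too short to contain
`aa`, this word is exempt. -/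
lemma next_eq_of_infix_specialCycle {a b c : Γ.Arrow} (h : [a, b] <:+: c.specialCycle) :
    b = a.next := by
  have := (c.isSuccChain_walk (Γ.val c.color)).infix h
  simpa using this

lemma infix_specialCycle (a : Γ.Arrow) (h : Γ.val a.color ≠ 1) :
    [a, a.next] <:+: a.specialCycle := by
  obtain ⟨n, hn⟩ : ∃ n, Γ.val a.color = 2 + n :=
    Nat.exists_eq_add_of_le (by have := Γ.val_pos a.color; omega)
  rw [specialCycle_eq_walk, hn, walk_add]
  exact (List.prefix_append _ _).isInfix

lemma next_eq_self (a : Γ.Arrow) (h : Γ.val a.color = 1) : a.next = a := by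
  have := a.next_iterate_val
  rwa [h] at this

/-- Every polygon contains a nontruncated vertex, hence is the source of some arrow. -/
lemma exists_src (V : Γ₁) : ∃ a : Γ.Arrow, a.src = V := by
  obtain ⟨α, hα, h⟩ := Γ.exists_one_lt V
  have hm : V ∈ Γ.order α := by
    rw [← List.count_pos_iff, Γ.count_order]
    exact Multiset.count_pos.2 hα
  obtain ⟨i, hi⟩ := List.get_of_mem hm
  refine ⟨⟨⟨α, fun ht => ?_⟩, i⟩, hi⟩
  have h1 : Γ.val α * Γ.mult α = 1 := by rw [ht.1, ht.2]
  exact absurd h (by rw [show (∑ W, (Γ.polygon W).count α) = Γ.val α from rfl, h1]; simp)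

end Arrow

open Classical in
instance : Fintype Γ.Arrow :=
  inferInstanceAs (Fintype (Σ α : {α : Γ₀ // ¬ Γ.IsTruncated α}, Fin (Γ.order α).length))

lemma exists_socleLength_le (Γ : BrauerConfiguration Γ₀ Γ₁) :
    ∃ N, ∀ a : Γ.Arrow, a.socleLength ≤ N :=
  ⟨Finset.univ.sup Arrow.socleLength, fun a => Finset.le_sup (Finset.mem_univ a)⟩

/-! ### Counting arrows and occurrences along the cyclic orders -/

lemma _root_.List.sum_get_eq_count {ι : Type*} [DecidableEq ι] (l : List ι) (V : ι) :
    ∑ i : Fin l.length, (if l.get i = V then 1 else 0) = l.count V := by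
  induction l with
  | nil => simp
  | cons b l ih =>
    refine (Fin.sum_univ_succ (n := l.length) _).trans ?_
    simp only [List.get_cons_zero, List.get_cons_succ', List.count_cons]
    rw [← ih, add_comm]
    simp only [beq_iff_eq]
    congr

/-- Once around the cyclic order at `α`, the polygon `W` is met `occ(α, W)` times, whatever the
starting point. -/
lemma Arrow.sum_range_val (a : Γ.Arrow) (W : Γ₁) :
    ∑ n ∈ Finset.range (Γ.val a.color), (if (next^[n] a).src = W then 1 else 0) =
      Γ.occ a.color W := by
  rw [← Γ.length_order, occ, ← Γ.count_order, ← List.sum_get_eq_count, Finset.sum_range]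
  have : NeZero (Γ.order a.color).length := ⟨a.2.pos.ne'⟩
  obtain ⟨i, hi⟩ : ∃ i : Fin (Γ.order a.color).length, i = a.2 := ⟨a.2, rfl⟩
  refine Fintype.sum_equiv (Equiv.addLeft i) _ _ fun k => ?_
  have h : (finRotate (Γ.order a.color).length)^[(k : ℕ)] i = i + k := by
    ext
    rw [val_finRotate_iterate, Fin.val_add]
  change _ = if (Γ.order a.color).get (i + k) = W then 1 else 0
  rw [← h, hi, next_iterate]
  rfl

lemma Arrow.sum_range_socleLength (a : Γ.Arrow) (W : Γ₁) :
    ∑ n ∈ Finset.range a.socleLength, (if (next^[n] a).src = W then 1 else 0) =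
      Γ.mult a.color * Γ.occ a.color W := by
  rw [socleLength]
  induction Γ.mult a.color with
  | zero => simp
  | succ m ih =>
    rw [mul_add, mul_one, Finset.sum_range_add, ih, add_mul, one_mul, ← a.sum_range_val]
    congr 1
    refine Finset.sum_congr rfl fun n _ => ?_
    rw [add_comm, Function.iterate_add_apply, next_iterate_val_mul]

open Classical in
/-- A sum over the arrows starting at `V` of a quantity depending on the underlying vertex only. -/
lemma sum_arrow_src (V : Γ₁) (f : Γ₀ → ℕ) :
    ∑ a : Γ.Arrow, (if a.src = V then f a.color else 0) =
      ∑ α ∈ Γ.support V, if Γ.IsTruncated α then 0 else Γ.occ α V * f α := by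
  have h1 : ∑ a : Γ.Arrow, (if a.src = V then f a.color else 0) =
      ∑ α : {α // ¬ Γ.IsTruncated α}, ∑ i : Fin (Γ.order α).length,
        if (Γ.order α).get i = V then f α else 0 := by
    exact Fintype.sum_sigma (α := fun α : {α // ¬ Γ.IsTruncated α} => Fin (Γ.order α).length) _
  have h2 (α : Γ₀) : ∑ i : Fin (Γ.order α).length, (if (Γ.order α).get i = V then f α else 0) =
      Γ.occ α V * f α := by
    rw [occ, ← Γ.count_order, ← List.sum_get_eq_count, Finset.sum_mul]
    simp
  rw [h1, Fintype.sum_congr _ _ fun α : {α // ¬ Γ.IsTruncated α} => h2 α,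
    ← Finset.sum_subtype (Finset.univ.filter fun α => ¬ Γ.IsTruncated α) (by simp)
      (fun α => Γ.occ α V * f α), Finset.sum_filter]
  simp only [ite_not]
  refine (Finset.sum_subset (Finset.subset_univ _) fun α _ hα => ?_).symm
  have : Γ.occ α V = 0 := by
    rw [occ, Multiset.count_eq_zero]
    simpa [support] using hα
  simp [this]

end BrauerConfiguration

/-! ### Paths in the path algebra -/

namespace PathAlgebra

variable {K Q : Type*} [Field K] [Quiver Q]

lemma ofPath_ne_zero (p : QuiverPath Q) : ofPath K p ≠ 0 :=
  Finsupp.single_ne_zero.2 one_ne_zero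

lemma span_range_ofPath : Submodule.span K (Set.range (ofPath (Q := Q) K)) = ⊤ := by
  have h : (Submodule.span K (Set.range (ofPath (Q := Q) K))).mkQ = 0 := hom_ext fun p => by
    rw [LinearMap.zero_apply, Submodule.mkQ_apply, Submodule.Quotient.mk_eq_zero]
    exact Submodule.subset_span ⟨p, rfl⟩
  rw [← Submodule.ker_mkQ (Submodule.span K _), h, LinearMap.ker_zero]

variable [Fintype Q]

lemma ofPath_mul_ofPath {i j k : Q} (p : Quiver.Path i j) (q : Quiver.Path j k) :
    ofPath K ⟨i, j, p⟩ * ofPath K ⟨j, k, q⟩ = ofPath K ⟨i, k, p.comp q⟩ :=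
  (mulLin_ofPath _ _).trans (mulPath_comp p q)

lemma ofPath_mul_of_ne {p q : QuiverPath Q} (h : p.2.1 ≠ q.1) :
    ofPath K p * ofPath K q = 0 :=
  (mulLin_ofPath _ _).trans (mulPath_of_ne h)

lemma vertex_mul_ofPath (p : QuiverPath Q) : vertex K p.1 * ofPath K p = ofPath K p := by
  obtain ⟨i, j, p⟩ := p
  rw [vertex, ofPath_mul_ofPath, Quiver.Path.nil_comp]

lemma ofPath_mul_vertex (p : QuiverPath Q) : ofPath K p * vertex K p.2.1 = ofPath K p := by
  obtain ⟨i, j, p⟩ := p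
  rw [vertex, ofPath_mul_ofPath, Quiver.Path.comp_nil]

lemma vertex_mul_of_ne {i : Q} {p : QuiverPath Q} (h : i ≠ p.1) :
    vertex K i * ofPath K p = 0 :=
  ofPath_mul_of_ne h

lemma mul_vertex_of_ne {i : Q} {p : QuiverPath Q} (h : p.2.1 ≠ i) :
    ofPath K p * vertex K i = 0 :=
  ofPath_mul_of_ne h

lemma completeOrthogonalIdempotents_vertex :
    CompleteOrthogonalIdempotents (vertex K : Q → PathAlgebra K Q) where
  idem i := vertex_mul_ofPath ⟨i, i, Quiver.Path.nil⟩
  ortho _ j h := vertex_mul_of_ne (p := ⟨j, j, Quiver.Path.nil⟩) h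
  complete := rfl

/-- To see that a linear map vanishes on all `x * z * y`, it suffices to look at paths `x`, `y`. -/
lemma map_mul_mul_eq_zero {M : Type*} [AddCommGroup M] [Module K M]
    (f : PathAlgebra K Q →ₗ[K] M) {z : PathAlgebra K Q}
    (h : ∀ p q, f (ofPath K p * z * ofPath K q) = 0) (x y : PathAlgebra K Q) :
    f (x * z * y) = 0 := by
  have h1 (p : QuiverPath Q) : f ∘ₗ LinearMap.mulLeft K (ofPath K p * z) = 0 :=
    hom_ext fun q => h p q
  have h2 : f ∘ₗ LinearMap.mulRight K (z * y) = 0 := hom_ext fun p => by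
    simpa [mul_assoc] using LinearMap.congr_fun (h1 p) y
  simpa [mul_assoc] using LinearMap.congr_fun h2 x

end PathAlgebra

namespace BrauerConfiguration

open PathAlgebra

variable {K : Type*} [Field K] {Γ₀ Γ₁ : Type*} [Fintype Γ₀] [Fintype Γ₁] [DecidableEq Γ₀]
  [DecidableEq Γ₁] {Γ : BrauerConfiguration Γ₀ Γ₁}

/-! ### Words of paths in the induced quiver -/

/-- The list of the arrows of a path between given vertices. -/
def pathWord {V : Γ.QuiverVertex} : ∀ {W : Γ.QuiverVertex}, Quiver.Path V W → List Γ.Arrow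
  | _, .nil => []
  | _, .cons p e => pathWord p ++ [e.1]

/-- The list of the arrows of a path. -/
def word (p : QuiverPath Γ.QuiverVertex) : List Γ.Arrow := pathWord p.2.2

lemma pathWord_comp {U V W : Γ.QuiverVertex} (p : Quiver.Path U V) (q : Quiver.Path V W) :
    pathWord (p.comp q) = pathWord p ++ pathWord q := by
  induction q with
  | nil => simp [pathWord]
  | cons q e ih => rw [Quiver.Path.comp_cons, pathWord, ih, pathWord, List.append_assoc]

variable (K) in
/-- The product of the arrows in a word, as an element of the path algebra. -/
def wordProd (l : List Γ.Arrow) : PathAlgebra K Γ.QuiverVertex :=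
  (l.map (Arrow.toPathAlgebra K)).prod

lemma wordProd_append (l l' : List Γ.Arrow) :
    wordProd K (l ++ l') = wordProd K l * wordProd K l' := by
  simp [wordProd]

lemma ofPath_cons {U V W : Γ.QuiverVertex} (p : Quiver.Path U V) (e : V ⟶ W) :
    ofPath K ⟨U, W, p.cons e⟩ = ofPath K ⟨U, V, p⟩ * e.1.toPathAlgebra K := by
  obtain ⟨a, rfl, rfl⟩ := e
  exact (ofPath_mul_ofPath p (Quiver.Hom.toPath ⟨a, rfl, rfl⟩)).symm

lemma ofPath_eq_vertex_mul (p : QuiverPath Γ.QuiverVertex) :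
    ofPath K p = vertex K p.1 * wordProd K (word p) := by
  obtain ⟨U, W, p⟩ := p
  induction p with
  | nil => simp [word, pathWord, wordProd, vertex]
  | cons p e ih =>
    rw [ofPath_cons, ih, mul_assoc, word, word, pathWord, wordProd_append]
    simp [wordProd]

/-- The path of length `n` running along the cyclic order, beginning with the arrow `a`. -/
def walkHom (a : Γ.Arrow) : ∀ n : ℕ,
    Quiver.Path (V := Γ.QuiverVertex) a.src (Arrow.next^[n] a).src
  | 0 => .nil
  | n + 1 => (walkHom a n).cons ⟨Arrow.next^[n] a, rfl, by
      rw [Function.iterate_succ_apply']; rfl⟩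

/-- The path of length `n` running along the cyclic order, beginning with the arrow `a`. -/
def walkPath (a : Γ.Arrow) (n : ℕ) : QuiverPath Γ.QuiverVertex := ⟨_, _, walkHom a n⟩

lemma snd_walkPath_socleLength (a : Γ.Arrow) :
    (walkPath a a.socleLength).2.1 = Arrow.src (Γ := Γ) a :=
  congrArg (Arrow.src (Γ := Γ)) a.next_iterate_socleLength

lemma vertex_mul_toPathAlgebra (a : Γ.Arrow) :
    vertex K (Q := Γ.QuiverVertex) a.src * a.toPathAlgebra K = a.toPathAlgebra K :=
  vertex_mul_ofPath (walkPath a 1)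

lemma vertex_mul_toPathAlgebra_of_ne {a : Γ.Arrow} {V : Γ.QuiverVertex} (h : V ≠ a.src) :
    vertex K V * a.toPathAlgebra K = 0 :=
  vertex_mul_of_ne (p := walkPath a 1) h

lemma fst_of_word_eq_cons {p : QuiverPath Γ.QuiverVertex} {a : Γ.Arrow} {l : List Γ.Arrow}
    (h : word p = a :: l) : p.1 = a.src := by
  by_contra hne
  -- The endpoints do not depend on the coefficient field, so any field may be used.
  refine ofPath_ne_zero (K := ℚ) p ?_
  rw [ofPath_eq_vertex_mul, h, wordProd, List.map_cons, List.prod_cons, ← mul_assoc,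
    vertex_mul_toPathAlgebra_of_ne hne, zero_mul]

/-- A nontrivial path is determined by its word. -/
lemma ofPath_eq_wordProd {p : QuiverPath Γ.QuiverVertex} (h : word p ≠ []) :
    ofPath K p = wordProd K (word p) := by
  obtain ⟨a, l, hl⟩ := List.exists_cons_of_ne_nil h
  rw [ofPath_eq_vertex_mul, fst_of_word_eq_cons hl, hl, wordProd, List.map_cons, List.prod_cons,
    ← mul_assoc, vertex_mul_toPathAlgebra]

lemma fst_eq_of_word_eq_nil {p : QuiverPath Γ.QuiverVertex} (h : word p = []) :
    ofPath K p = vertex K p.1 := by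
  rw [ofPath_eq_vertex_mul, h]
  simp [wordProd]

lemma word_walkPath (a : Γ.Arrow) (n : ℕ) : word (walkPath a n) = a.walk n := by
  induction n with
  | zero => rfl
  | succ n ih =>
    rw [Arrow.walk_succ, ← ih]
    rfl

lemma wordProd_walk (a : Γ.Arrow) {n : ℕ} (hn : n ≠ 0) :
    wordProd K (a.walk n) = ofPath K (walkPath a n) := by
  rw [← word_walkPath, ← ofPath_eq_wordProd]
  rw [word_walkPath, ← List.length_pos_iff, Arrow.length_walk]
  omega

lemma Arrow.cycle_pow (a : Γ.Arrow) (m : ℕ) :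
    a.cycle K ^ m = wordProd K (a.walk (Γ.val a.color * m)) := by
  induction m with
  | zero => simp [wordProd, walk]
  | succ m ih =>
    rw [pow_succ, ih, mul_add, mul_one, walk_add, next_iterate_val_mul, wordProd_append]
    rfl

lemma Arrow.cycle_pow_mult (a : Γ.Arrow) :
    a.cycle K ^ Γ.mult a.color = ofPath K (walkPath a a.socleLength) := by
  rw [cycle_pow, ← socleLength, wordProd_walk _ (by have := a.one_lt_socleLength; omega)]

lemma Arrow.cycle_pow_mult_mul (a : Γ.Arrow) :
    a.cycle K ^ Γ.mult a.color * a.toPathAlgebra K =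
      ofPath K (walkPath a (a.socleLength + 1)) := by
  rw [← wordProd_walk _ (Nat.succ_ne_zero _), walk_succ, wordProd_append,
    next_iterate_socleLength, cycle_pow, ← socleLength]
  simp [wordProd]

/-! ### Normal forms of paths -/

variable (Γ) in
/-- The index set of a basis of the Brauer configuration algebra: the trivial paths, one socle
element `C ^ μ(α)` for each vertex of the quiver, and for each arrow `a` the paths beginning
with `a` that run along the cyclic order and are shorter than `C ^ μ(α)`; the last index `k` stands
for the path of length `k + 1`. -/
abbrev BasisIndex := Γ₁ ⊕ Γ₁ ⊕ Σ a : Γ.Arrow, Fin (a.socleLength - 1)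

variable (K) in
open Classical in
/-- The normal form, in terms of the basis of the Brauer configuration algebra, of the path with
source `V` and the given word. -/
def wordNormalForm (V : Γ.QuiverVertex) : List Γ.Arrow → (Γ.BasisIndex →₀ K)
  | [] => Finsupp.single (.inl V) 1
  | a :: l =>
    if IsSuccChain (a :: l) then
      if h : l.length < a.socleLength - 1 then Finsupp.single (.inr (.inr ⟨a, l.length, h⟩)) 1
      else if l.length + 1 = a.socleLength then Finsupp.single (.inr (.inl a.src)) 1 else 0
    else 0

lemma wordNormalForm_of_not_isSuccChain (V : Γ.QuiverVertex) {l : List Γ.Arrow}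
    (h : ¬ IsSuccChain l) :
    wordNormalForm K V l = 0 := by
  cases l with
  | nil => exact absurd .nil h
  | cons a l => rw [wordNormalForm, if_neg h]

lemma wordNormalForm_of_lt_length (V : Γ.QuiverVertex) {l : List Γ.Arrow} {a : Γ.Arrow} (ha : a ∈ l)
    (h : a.socleLength < l.length) : wordNormalForm K V l = 0 := by
  by_cases hc : IsSuccChain l
  · cases l with
    | nil => simp at ha
    | cons b l =>
      rw [Arrow.socleLength_eq (Arrow.color_eq_of_isSuccChain hc ha List.mem_cons_self),
        List.length_cons] at h
      rw [wordNormalForm, if_pos hc, dif_neg (by omega), if_neg (by omega)]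
  · exact wordNormalForm_of_not_isSuccChain V hc

lemma wordNormalForm_walk (V : Γ.QuiverVertex) (a : Γ.Arrow) (k : Fin (a.socleLength - 1)) :
    wordNormalForm K V (a.walk (k + 1)) = Finsupp.single (.inr (.inr ⟨a, k⟩)) 1 := by
  have hc := a.isSuccChain_walk (k + 1)
  rw [Arrow.walk_succ'] at hc ⊢
  rw [wordNormalForm, if_pos hc]
  simp

lemma wordNormalForm_walk_socleLength (V : Γ.QuiverVertex) (a : Γ.Arrow) :
    wordNormalForm K V (a.walk a.socleLength) = Finsupp.single (.inr (.inl a.src)) 1 := by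
  have hc := a.isSuccChain_walk a.socleLength
  obtain ⟨n, hn⟩ : ∃ n, a.socleLength = n + 1 :=
    Nat.exists_eq_add_one_of_ne_zero (by have := a.one_lt_socleLength; omega)
  rw [hn, Arrow.walk_succ'] at hc ⊢
  rw [wordNormalForm, if_pos hc, dif_neg (by simp [hn]), if_pos (by simp [hn])]

variable (K Γ) in
/-- The linear extension of the normal form to the path algebra. -/
def normalForm : PathAlgebra K Γ.QuiverVertex →ₗ[K] (Γ.BasisIndex →₀ K) :=
  linearLift K fun p => wordNormalForm K p.1 (word p)

lemma normalForm_ofPath (p : QuiverPath Γ.QuiverVertex) :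
    normalForm K Γ (ofPath K p) = wordNormalForm K p.1 (word p) :=
  linearLift_ofPath K _ p

open Classical in
/-- The normal form of a product of three paths. -/
lemma normalForm_mul_mul (p r q : QuiverPath Γ.QuiverVertex) :
    normalForm K Γ (ofPath K p * ofPath K r * ofPath K q) =
      if p.2.1 = r.1 ∧ r.2.1 = q.1 then wordNormalForm K p.1 (word p ++ (word r ++ word q))
      else 0 := by
  split_ifs with h
  · obtain ⟨U, V, p⟩ := p
    obtain ⟨V', W, r⟩ := r
    obtain ⟨W', X, q⟩ := q
    obtain ⟨rfl, rfl⟩ : V = V' ∧ W = W' := h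
    rw [mul_assoc, ofPath_mul_ofPath, ofPath_mul_ofPath, normalForm_ofPath]
    simp only [word, pathWord_comp]
  · rw [not_and_or] at h
    obtain h | h := h
    · rw [ofPath_mul_of_ne h, zero_mul, map_zero]
    · rw [mul_assoc, ofPath_mul_of_ne h, mul_zero, map_zero]

lemma normalForm_mul_mul_eq_zero {r : QuiverPath Γ.QuiverVertex}
    (h : ∀ (V : Γ.QuiverVertex) (l l' : List Γ.Arrow), wordNormalForm K V (l ++ (word r ++ l')) = 0)
    (x y : PathAlgebra K Γ.QuiverVertex) : normalForm K Γ (x * ofPath K r * y) = 0 := by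
  refine map_mul_mul_eq_zero _ (fun p q => ?_) x y
  rw [normalForm_mul_mul]
  split_ifs
  · exact h _ _ _
  · rfl

lemma mem_walk_self (a : Γ.Arrow) {n : ℕ} (hn : n ≠ 0) : a ∈ a.walk n := by
  obtain ⟨n, rfl⟩ := Nat.exists_eq_add_one_of_ne_zero hn
  rw [Arrow.walk_succ']
  exact List.mem_cons_self

/-- A word containing `C ^ μ(α)` has a nonzero normal form only if nothing else is in it. -/
lemma wordNormalForm_append_socle (V : Γ.QuiverVertex) (a : Γ.Arrow) (l l' : List Γ.Arrow) :
    wordNormalForm K V (l ++ (a.walk a.socleLength ++ l')) =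
      if l = [] ∧ l' = [] then Finsupp.single (.inr (.inl a.src)) 1 else 0 := by
  have ha : a ∈ a.walk a.socleLength := mem_walk_self a (by have := a.one_lt_socleLength; omega)
  split_ifs with h
  · rw [h.1, h.2, List.append_nil, List.nil_append, wordNormalForm_walk_socleLength]
  · refine wordNormalForm_of_lt_length V (a := a) (by simp [ha]) ?_
    have : l.length ≠ 0 ∨ l'.length ≠ 0 := by
      simpa only [ne_eq, List.length_eq_zero_iff, not_and_or] using h
    simp only [List.length_append, Arrow.length_walk]
    omega

lemma normalForm_relationsOne {a b : Γ.Arrow} (h : a.src = b.src)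
    (x y : PathAlgebra K Γ.QuiverVertex) :
    normalForm K Γ (x * (a.cycle K ^ Γ.mult a.color - b.cycle K ^ Γ.mult b.color) * y) = 0 := by
  refine map_mul_mul_eq_zero _ (fun p q => ?_) x y
  have h1 : (walkPath a a.socleLength).1 = (walkPath b b.socleLength).1 := h
  have h2 : (walkPath a a.socleLength).2.1 = (walkPath b b.socleLength).2.1 := by
    rw [snd_walkPath_socleLength, snd_walkPath_socleLength, h]
  rw [mul_sub, sub_mul, map_sub, sub_eq_zero, a.cycle_pow_mult, b.cycle_pow_mult,
    normalForm_mul_mul, normalForm_mul_mul, word_walkPath, word_walkPath,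
    wordNormalForm_append_socle, wordNormalForm_append_socle, h2, h1, h]

/-- The normal form vanishes on the ideal of relations. -/
lemma normalForm_eq_zero {z : PathAlgebra K Γ.QuiverVertex} (hz : z ∈ Γ.relationIdeal K) :
    normalForm K Γ z = 0 := by
  let J : TwoSidedIdeal (PathAlgebra K Γ.QuiverVertex) :=
    TwoSidedIdeal.mk' {z | ∀ x y, normalForm K Γ (x * z * y) = 0} (fun x y => by simp)
      (fun {z w} hz hw x y => by rw [mul_add, add_mul, map_add, hz, hw, add_zero])
      (fun {z} hz x y => by rw [mul_neg, neg_mul, map_neg, hz, neg_zero])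
      (fun {w z} hz x y => by rw [← mul_assoc x w z, hz])
      (fun {z w} hz x y => by rw [← mul_assoc x z w, mul_assoc (x * z), hz])
  have hJ (z) : z ∈ J ↔ ∀ x y, normalForm K Γ (x * z * y) = 0 := TwoSidedIdeal.mem_mk' ..
  have hle : Γ.relationIdeal K ≤ J := by
    refine TwoSidedIdeal.span_le.2 ?_
    rintro z ((⟨a, b, h, rfl⟩ | ⟨a, rfl⟩) | ⟨a, b, h, hab, hab', rfl⟩)
    · exact (hJ _).2 (normalForm_relationsOne h)
    · refine (hJ _).2 ?_
      rw [a.cycle_pow_mult_mul]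
      refine normalForm_mul_mul_eq_zero fun V l l' => ?_
      rw [word_walkPath]
      refine wordNormalForm_of_lt_length V (a := a) ?_ ?_
      · simp [mem_walk_self a (Nat.succ_ne_zero _)]
      · simp only [List.length_append, Arrow.length_walk]
        omega
    · have hne : b ≠ a.next := by
        rintro rfl
        by_cases hv : Γ.val a.color = 1
        · exact hab' ⟨(a.next_eq_self hv).symm, hv⟩
        · exact hab a (a.infix_specialCycle hv)
      let r : QuiverPath Γ.QuiverVertex :=
        ⟨a.src, b.tgt, (walkHom a 1).cons ⟨b, h.symm, rfl⟩⟩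
      have hr : word r = [a, b] := rfl
      have hr' : a.toPathAlgebra K * b.toPathAlgebra K = ofPath K r := by
        rw [ofPath_eq_wordProd (by simp [hr]), hr]
        simp [wordProd]
      refine (hJ _).2 ?_
      rw [hr']
      refine normalForm_mul_mul_eq_zero fun V l l' => ?_
      rw [hr]
      refine wordNormalForm_of_not_isSuccChain V fun hc => hne ?_
      have := hc.infix (l₁ := [a, b]) ⟨l, l', by simp⟩
      simpa using this
  simpa using (hJ z).1 (hle hz) 1 1

/-! ### Classes of paths in the Brauer configuration algebra -/

variable (K Γ) in
/-- The projection from the path algebra onto the Brauer configuration algebra. -/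
def proj : PathAlgebra K Γ.QuiverVertex →ₐ[K] Γ.BrauerAlgebra K := (Γ.relationIdeal K).ringCon.mkₐ K

lemma proj_surjective : Function.Surjective (proj K Γ) :=
  (Γ.relationIdeal K).ringCon.mkₐ_surjective

lemma proj_eq_zero_iff {x : PathAlgebra K Γ.QuiverVertex} :
    proj K Γ x = 0 ↔ x ∈ Γ.relationIdeal K :=
  (RingCon.eq _).trans (TwoSidedIdeal.mem_iff _ _).symm

lemma proj_eq_zero_of_mem {x : PathAlgebra K Γ.QuiverVertex}
    (h : x ∈ Γ.relationsOne K ∪ Γ.relationsTwo K ∪ Γ.relationsThree K) : proj K Γ x = 0 :=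
  proj_eq_zero_iff.2 (TwoSidedIdeal.subset_span h)

lemma proj_vertex (V : Γ₁) : proj K Γ (vertex K (Q := Γ.QuiverVertex) V) = Γ.idempotent K V := rfl

lemma span_range_proj_ofPath :
    Submodule.span K
      (Set.range fun p : QuiverPath Γ.QuiverVertex => proj K Γ (ofPath K p)) = ⊤ := by
  rw [show (fun p : QuiverPath Γ.QuiverVertex => proj K Γ (ofPath K p)) =
      (proj K Γ).toLinearMap ∘ ofPath K from rfl, Set.range_comp, Submodule.span_image,
    span_range_ofPath, Submodule.map_top]
  exact LinearMap.range_eq_top.2 proj_surjective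

lemma proj_mul_eq_zero_of_ne_next {a b : Γ.Arrow} (h : b ≠ a.next) :
    proj K Γ (a.toPathAlgebra K * b.toPathAlgebra K) = 0 := by
  by_cases hab : a.tgt = b.src
  · refine proj_eq_zero_of_mem (Or.inr ⟨a, b, hab, fun c hc => ?_, fun hc => ?_, rfl⟩)
    · exact h (Arrow.next_eq_of_infix_specialCycle hc)
    · obtain ⟨rfl, hv⟩ := hc
      exact h (a.next_eq_self hv).symm
  · have : a.toPathAlgebra K * b.toPathAlgebra K = 0 :=
      ofPath_mul_of_ne (p := walkPath a 1) (q := walkPath b 1) hab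
    rw [this, map_zero]

lemma proj_wordProd_of_not_isSuccChain {l : List Γ.Arrow} (h : ¬ IsSuccChain l) :
    proj K Γ (wordProd K l) = 0 := by
  induction l with
  | nil => exact absurd .nil h
  | cons a l ih =>
    cases l with
    | nil => exact absurd (.singleton _) h
    | cons b l =>
      by_cases hb : b = a.next
      · have hl : ¬ IsSuccChain (b :: l) := fun hl => h (.cons_cons hb hl)
        rw [wordProd, List.map_cons, List.prod_cons, map_mul]
        exact (congrArg _ (ih hl)).trans (mul_zero _)
      · rw [wordProd, List.map_cons, List.prod_cons, List.map_cons, List.prod_cons, ← mul_assoc,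
          map_mul, proj_mul_eq_zero_of_ne_next hb, zero_mul]

lemma proj_wordProd_walk_eq_zero {a : Γ.Arrow} {n : ℕ} (h : a.socleLength < n) :
    proj K Γ (wordProd K (a.walk n)) = 0 := by
  obtain ⟨k, rfl⟩ := Nat.exists_eq_add_of_le (Nat.succ_le_of_lt h)
  have h0 : proj K Γ (wordProd K (a.walk (a.socleLength + 1))) = 0 :=
    proj_eq_zero_of_mem (Or.inl (Or.inr ⟨a, by
      rw [a.cycle_pow_mult_mul, wordProd_walk _ (Nat.add_one_ne_zero _)]⟩))
  rw [Arrow.walk_add, wordProd_append, map_mul, Nat.succ_eq_add_one, h0, zero_mul]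

lemma proj_walkPath_socleLength {a b : Γ.Arrow} (h : a.src = b.src) :
    proj K Γ (ofPath K (walkPath a a.socleLength)) =
      proj K Γ (ofPath K (walkPath b b.socleLength)) := by
  rw [← sub_eq_zero, ← map_sub]
  refine proj_eq_zero_of_mem (Or.inl (Or.inl ⟨a, b, h, ?_⟩))
  rw [a.cycle_pow_mult, b.cycle_pow_mult]

/-! ### The basis of the Brauer configuration algebra -/

/-- An arbitrary arrow with source `V`; it selects the representative `C ^ μ(α)` of the socle
element at `V`. -/
def socleArrow (V : Γ₁) : Γ.Arrow := (Arrow.exists_src (Γ := Γ) V).choose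

lemma src_socleArrow (V : Γ₁) : (socleArrow (Γ := Γ) V).src = V :=
  (Arrow.exists_src (Γ := Γ) V).choose_spec

/-- The paths whose classes form a basis of the Brauer configuration algebra. -/
def basisPath : Γ.BasisIndex → QuiverPath Γ.QuiverVertex
  | .inl V => ⟨V, V, .nil⟩
  | .inr (.inl V) => walkPath (socleArrow V) (socleArrow (Γ := Γ) V).socleLength
  | .inr (.inr ⟨a, k⟩) => walkPath a (k + 1)

lemma normalForm_basisPath (b : Γ.BasisIndex) :
    normalForm K Γ (ofPath K (basisPath b)) = Finsupp.single b 1 := by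
  rw [normalForm_ofPath]
  obtain V | V | ⟨a, k⟩ := b
  · rfl
  · rw [basisPath, word_walkPath, wordNormalForm_walk_socleLength, src_socleArrow]
  · rw [basisPath, word_walkPath, wordNormalForm_walk]

variable (K) in
/-- The basis vectors of the Brauer configuration algebra. -/
def basisVector (b : Γ.BasisIndex) : Γ.BrauerAlgebra K := proj K Γ (ofPath K (basisPath b))

lemma linearIndependent_basisVector : LinearIndependent K (basisVector K (Γ := Γ)) := by
  rw [Fintype.linearIndependent_iff]
  intro g hg b
  have h1 : proj K Γ (∑ c, g c • ofPath K (basisPath c)) = 0 := by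
    rw [← hg, map_sum]
    exact Finset.sum_congr rfl fun c _ => map_smul _ _ _
  have h2 := normalForm_eq_zero (proj_eq_zero_iff.1 h1)
  simp only [map_sum, map_smul, normalForm_basisPath] at h2
  have h3 := DFunLike.congr_fun h2 b
  rw [Finsupp.finsetSum_apply, Finset.sum_eq_single b (fun c _ hc => by simp [hc]) (by simp)] at h3
  simpa using h3

/-- The class of a path is zero or a basis vector. -/
lemma proj_ofPath_eq (p : QuiverPath Γ.QuiverVertex) :
    proj K Γ (ofPath K p) = 0 ∨ ∃ b, proj K Γ (ofPath K p) = basisVector K b := by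
  cases hw : word p with
  | nil => exact Or.inr ⟨.inl p.1, by rw [fst_eq_of_word_eq_nil hw]; rfl⟩
  | cons a l =>
    rw [ofPath_eq_wordProd (by simp [hw]), hw]
    by_cases hc : IsSuccChain (a :: l)
    · rw [Arrow.eq_walk_of_isSuccChain hc]
      obtain h | h | h := lt_trichotomy (l.length + 1) a.socleLength
      · refine Or.inr ⟨.inr (.inr ⟨a, l.length, by omega⟩), ?_⟩
        rw [wordProd_walk _ (Nat.add_one_ne_zero _)]
        rfl
      · refine Or.inr ⟨.inr (.inl a.src), ?_⟩
        rw [wordProd_walk _ (Nat.add_one_ne_zero _), h]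
        exact proj_walkPath_socleLength (src_socleArrow _).symm
      · exact Or.inl (proj_wordProd_walk_eq_zero h)
    · exact Or.inl (proj_wordProd_of_not_isSuccChain hc)

lemma span_range_basisVector : Submodule.span K (Set.range (basisVector K (Γ := Γ))) = ⊤ := by
  rw [eq_top_iff, ← span_range_proj_ofPath, Submodule.span_le]
  rintro _ ⟨p, rfl⟩
  change proj K Γ (ofPath K p) ∈ _
  obtain h | ⟨b, h⟩ := proj_ofPath_eq (K := K) p
  · rw [h]; exact Submodule.zero_mem _
  · rw [h]; exact Submodule.subset_span ⟨b, rfl⟩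

lemma finite_brauerAlgebra : Module.Finite K (Γ.BrauerAlgebra K) :=
  .of_fg_top ⟨(Set.finite_range (basisVector K (Γ := Γ))).toFinset, by
    rw [Set.Finite.coe_toFinset, span_range_basisVector]⟩

lemma idempotent_eq_basisVector (V : Γ₁) : Γ.idempotent K V = basisVector K (.inl V) := rfl

lemma idempotent_ne_zero (V : Γ₁) : Γ.idempotent K V ≠ 0 := by
  have := (linearIndependent_basisVector (K := K) (Γ := Γ)).ne_zero (.inl V)
  rwa [← idempotent_eq_basisVector] at this

lemma completeOrthogonalIdempotents_idempotent :
    CompleteOrthogonalIdempotents (Γ.idempotent K) :=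
  (completeOrthogonalIdempotents_vertex (K := K) (Q := Γ.QuiverVertex)).map (proj K Γ).toRingHom

lemma idempotent_mul_proj_mul (V W : Γ₁) (p : QuiverPath Γ.QuiverVertex)
    [Decidable (p.1 = V ∧ p.2.1 = W)] :
    Γ.idempotent K V * proj K Γ (ofPath K p) * Γ.idempotent K W =
      if p.1 = V ∧ p.2.1 = W then proj K Γ (ofPath K p) else 0 := by
  rw [← proj_vertex, ← proj_vertex, ← map_mul, ← map_mul]
  split_ifs with h
  · obtain ⟨rfl, rfl⟩ := h
    rw [vertex_mul_ofPath, ofPath_mul_vertex]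
  · rw [not_and_or] at h
    obtain h | h := h
    · rw [vertex_mul_of_ne (Ne.symm h), zero_mul, map_zero]
    · rw [mul_assoc, mul_vertex_of_ne h, mul_zero, map_zero]

/-! ### Nilpotency of the arrow ideal, and primitivity of the idempotents -/

variable (K Γ) in
/-- The `n`-th power of the arrow ideal: the span of the classes of the paths of length at least
`n`. -/
def pathPower (n : ℕ) : Submodule K (Γ.BrauerAlgebra K) :=
  Submodule.span K ((fun p => proj K Γ (ofPath K p)) '' {p | n ≤ (word p).length})

lemma proj_mem_pathPower {n : ℕ} {p : QuiverPath Γ.QuiverVertex} (h : n ≤ (word p).length) :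
    proj K Γ (ofPath K p) ∈ pathPower K Γ n :=
  Submodule.subset_span ⟨p, h, rfl⟩

lemma pathPower_mul_le (m n : ℕ) :
    pathPower K Γ m * pathPower K Γ n ≤ pathPower K Γ (m + n) := by
  rw [pathPower, pathPower, Submodule.span_mul_span, Submodule.span_le]
  rintro _ ⟨_, ⟨p, hp, rfl⟩, _, ⟨q, hq, rfl⟩, rfl⟩
  change proj K Γ (ofPath K p) * proj K Γ (ofPath K q) ∈ _
  rw [← map_mul]
  by_cases h : p.2.1 = q.1
  · obtain ⟨U, V, p⟩ := p
    obtain ⟨V', W, q⟩ := q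
    obtain rfl : V = V' := h
    rw [ofPath_mul_ofPath]
    refine proj_mem_pathPower ?_
    rw [word, pathWord_comp, List.length_append]
    exact add_le_add hp hq
  · rw [ofPath_mul_of_ne h, map_zero]
    exact Submodule.zero_mem _

lemma exists_pathPower_eq_bot : ∃ N, pathPower K Γ (N + 1) = ⊥ := by
  obtain ⟨N, hN⟩ := Γ.exists_socleLength_le
  refine ⟨N, ?_⟩
  rw [pathPower, Submodule.span_eq_bot]
  rintro _ ⟨p, hp, rfl⟩
  change proj K Γ (ofPath K p) = 0
  rw [Set.mem_ofPred_eq] at hp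
  cases hw : word p with
  | nil => simp [hw] at hp
  | cons a l =>
    rw [ofPath_eq_wordProd (by simp [hw]), hw]
    by_cases hc : IsSuccChain (a :: l)
    · rw [Arrow.eq_walk_of_isSuccChain hc]
      refine proj_wordProd_walk_eq_zero ((hN a).trans_lt ?_)
      rw [hw, List.length_cons] at hp
      omega
    · exact proj_wordProd_of_not_isSuccChain hc

lemma eq_zero_of_mem_pathPower {f : Γ.BrauerAlgebra K} (hf : IsIdempotentElem f)
    (h : f ∈ pathPower K Γ 1) : f = 0 := by
  have hn (n : ℕ) : f ∈ pathPower K Γ (n + 1) := by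
    induction n with
    | zero => exact h
    | succ n ih =>
      rw [← hf.eq]
      exact pathPower_mul_le _ _ (Submodule.mul_mem_mul ih h)
  obtain ⟨N, hN⟩ := exists_pathPower_eq_bot (K := K) (Γ := Γ)
  simpa [hN] using hn N

lemma mul_mem_pathPower_one {x y : Γ.BrauerAlgebra K} (hx : x ∈ pathPower K Γ 1)
    (hy : y ∈ pathPower K Γ 1) : x * y ∈ pathPower K Γ 1 := by
  refine Submodule.span_mono (Set.image_mono fun p hp => ?_)
    (pathPower_mul_le _ _ (Submodule.mul_mem_mul hx hy))
  exact (Nat.le_succ 1).trans hp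

lemma idempotent_notMem_pathPower (V : Γ₁) : Γ.idempotent K V ∉ pathPower K Γ 1 := fun h =>
  idempotent_ne_zero V
    (eq_zero_of_mem_pathPower (completeOrthogonalIdempotents_idempotent.idem V) h)

lemma idempotent_mul_mul_mem {V W : Γ₁} (h : V ≠ W) (x : Γ.BrauerAlgebra K) :
    Γ.idempotent K V * x * Γ.idempotent K W ∈ pathPower K Γ 1 := by
  classical
  have hx : x ∈ Submodule.span K
      (Set.range fun p : QuiverPath Γ.QuiverVertex => proj K Γ (ofPath K p)) := by
    rw [span_range_proj_ofPath]; trivial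
  induction hx using Submodule.span_induction with
  | mem x hx =>
    obtain ⟨p, rfl⟩ := hx
    change Γ.idempotent K V * proj K Γ (ofPath K p) * Γ.idempotent K W ∈ _
    rw [idempotent_mul_proj_mul V W p]
    split_ifs with hp
    · refine proj_mem_pathPower (Nat.one_le_iff_ne_zero.2 fun h0 => h ?_)
      obtain ⟨U, U', p⟩ := p
      obtain ⟨rfl, rfl⟩ := hp
      cases p with
      | nil => rfl
      | cons p e => simp [word, pathWord] at h0
    · exact Submodule.zero_mem _
  | zero => simp
  | add x y _ _ hx hy => rw [mul_add, add_mul]; exact Submodule.add_mem _ hx hy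
  | smul c x _ hx => rw [mul_smul_comm, smul_mul_assoc]; exact Submodule.smul_mem _ c hx

lemma exists_idempotent_mul_mul_sub_mem (V : Γ₁) (x : Γ.BrauerAlgebra K) :
    ∃ c : K, Γ.idempotent K V * x * Γ.idempotent K V - c • Γ.idempotent K V ∈
      pathPower K Γ 1 := by
  classical
  have hx : x ∈ Submodule.span K
      (Set.range fun p : QuiverPath Γ.QuiverVertex => proj K Γ (ofPath K p)) := by
    rw [span_range_proj_ofPath]; trivial
  induction hx using Submodule.span_induction with
  | mem x hx =>
    obtain ⟨p, rfl⟩ := hx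
    change ∃ c : K, Γ.idempotent K V * proj K Γ (ofPath K p) * Γ.idempotent K V - _ ∈ _
    rw [idempotent_mul_proj_mul V V p]
    split_ifs with hp
    · by_cases hw : word p = []
      · refine ⟨1, ?_⟩
        rw [fst_eq_of_word_eq_nil hw, hp.1, proj_vertex, one_smul, sub_self]
        exact Submodule.zero_mem _
      · refine ⟨0, ?_⟩
        rw [zero_smul, sub_zero]
        exact proj_mem_pathPower (List.length_pos_iff.2 hw)
    · exact ⟨0, by simp⟩
  | zero => exact ⟨0, by simp⟩
  | add x y _ _ hx hy =>
    obtain ⟨c, hc⟩ := hx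
    obtain ⟨d, hd⟩ := hy
    refine ⟨c + d, ?_⟩
    rw [mul_add, add_mul, add_smul, add_sub_add_comm]
    exact Submodule.add_mem _ hc hd
  | smul d x _ hx =>
    obtain ⟨c, hc⟩ := hx
    refine ⟨d * c, ?_⟩
    rw [mul_smul_comm, smul_mul_assoc, mul_smul, ← smul_sub]
    exact Submodule.smul_mem _ d hc

lemma isPrimitiveIdempotent_idempotent (V : Γ₁) :
    IsPrimitiveIdempotent (Γ.idempotent K V) := by
  have he := (completeOrthogonalIdempotents_idempotent (K := K) (Γ := Γ)).idem V
  refine ⟨he, idempotent_ne_zero V, fun f g hf hg hfg hgf h => ?_⟩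
  set e := Γ.idempotent K V with he'
  have hef : e * f = f := by rw [h, add_mul, hf.eq, hgf, add_zero]
  have hfe : f * e = f := by rw [h, mul_add, hf.eq, hfg, add_zero]
  obtain ⟨c, hc⟩ := exists_idempotent_mul_mul_sub_mem V f
  rw [← he', hef, hfe] at hc
  -- Modulo the arrow ideal `f` is `c • e` and `g` is `(1 - c) • e`, with product `0`.
  obtain ⟨r, hr, rfl⟩ : ∃ r ∈ pathPower K Γ 1, f = c • e + r := ⟨_, hc, by abel⟩
  have hg' : g = (1 - c) • e - r := by
    rw [sub_smul, one_smul]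
    nth_rewrite 1 [h]
    abel
  have her : e * r = r := by
    rw [mul_add, mul_smul_comm, he.eq] at hef
    exact add_left_cancel hef
  have hre : r * e = r := by
    rw [add_mul, smul_mul_assoc, he.eq] at hfe
    exact add_left_cancel hfe
  have hmem : (c * (1 - c)) • e ∈ pathPower K Γ 1 := by
    have h0 : (c * (1 - c)) • e = c • r - (1 - c) • r + r * r := by
      have : (c • e + r) * ((1 - c) • e - r) = 0 := by rw [← hg', hfg]
      rw [add_mul, mul_sub, mul_sub, smul_mul_smul_comm, he.eq, smul_mul_assoc, her,
        mul_smul_comm, hre] at this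
      rw [← sub_eq_zero, ← this]
      abel
    rw [h0]
    exact Submodule.add_mem _ (Submodule.sub_mem _ (Submodule.smul_mem _ _ hr)
      (Submodule.smul_mem _ _ hr)) (mul_mem_pathPower_one hr hr)
  have hcc : c * (1 - c) = 0 := by
    by_contra hne
    exact idempotent_notMem_pathPower V ((Submodule.smul_mem_iff _ hne).1 hmem)
  obtain rfl | h1 := mul_eq_zero.1 hcc
  · left
    refine eq_zero_of_mem_pathPower hf ?_
    rwa [zero_smul, zero_add]
  · right
    refine eq_zero_of_mem_pathPower hg ?_
    rw [hg', h1, zero_smul, zero_sub]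
    exact Submodule.neg_mem _ hr

/-- Mutually inverse isomorphisms between `eΛ` and `e'Λ` would write `e'` as a product of elements
of `e'Λe` and `eΛe'`, which both lie in the arrow ideal if `e ≠ e'`. -/
lemma isEmpty_linearEquiv_span_idempotent {V W : Γ₁} (h : V ≠ W) :
    IsEmpty (Submodule.span (Γ.BrauerAlgebra K)ᵐᵒᵖ {Γ.idempotent K V} ≃ₗ[(Γ.BrauerAlgebra K)ᵐᵒᵖ]
      Submodule.span (Γ.BrauerAlgebra K)ᵐᵒᵖ {Γ.idempotent K W}) := by
  refine ⟨fun φ => idempotent_notMem_pathPower (K := K) (Γ := Γ) W ?_⟩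
  have hidem := (completeOrthogonalIdempotents_idempotent (K := K) (Γ := Γ)).idem
  have hspan (U : Γ₁) {x : Γ.BrauerAlgebra K}
      (hx : x ∈ Submodule.span (Γ.BrauerAlgebra K)ᵐᵒᵖ {Γ.idempotent K U}) :
      Γ.idempotent K U * x = x := by
    obtain ⟨a, rfl⟩ := Submodule.mem_span_singleton.1 hx
    rw [MulOpposite.smul_eq_mul_unop, ← mul_assoc, (hidem U).eq]
  let eV : Submodule.span (Γ.BrauerAlgebra K)ᵐᵒᵖ {Γ.idempotent K V} :=
    ⟨_, Submodule.mem_span_singleton_self _⟩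
  let eW : Submodule.span (Γ.BrauerAlgebra K)ᵐᵒᵖ {Γ.idempotent K W} :=
    ⟨_, Submodule.mem_span_singleton_self _⟩
  have hV (y : Submodule.span (Γ.BrauerAlgebra K)ᵐᵒᵖ {Γ.idempotent K V}) :
      y = MulOpposite.op (y : Γ.BrauerAlgebra K) • eV :=
    Subtype.ext (hspan V y.2).symm
  have hW (y : Submodule.span (Γ.BrauerAlgebra K)ᵐᵒᵖ {Γ.idempotent K W}) :
      y = MulOpposite.op (y : Γ.BrauerAlgebra K) • eW :=
    Subtype.ext (hspan W y.2).symm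
  set x := φ eV with hx
  set y := φ.symm eW with hy
  have hxV : (x : Γ.BrauerAlgebra K) * Γ.idempotent K V = x := by
    have : MulOpposite.op (Γ.idempotent K V) • x = x := by
      rw [hx, ← map_smul]
      exact congrArg φ (hV eV).symm
    exact congrArg Subtype.val this
  have hyW : (y : Γ.BrauerAlgebra K) * Γ.idempotent K W = y := by
    have : MulOpposite.op (Γ.idempotent K W) • y = y := by
      rw [hy, ← map_smul]
      exact congrArg φ.symm (hW eW).symm
    exact congrArg Subtype.val this
  have hxy : (x : Γ.BrauerAlgebra K) * y = Γ.idempotent K W := by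
    have : MulOpposite.op (y : Γ.BrauerAlgebra K) • x = eW := by
      rw [hx, ← map_smul, ← hV y, hy, LinearEquiv.apply_symm_apply]
    exact congrArg Subtype.val this
  rw [← hxy]
  refine mul_mem_pathPower_one ?_ ?_
  · rw [← hxV, ← hspan W x.2]
    exact idempotent_mul_mul_mem h.symm _
  · rw [← hyW, ← hspan V y.2]
    exact idempotent_mul_mul_mem h _

lemma isBasicIdempotentFamily_idempotent : IsBasicIdempotentFamily (Γ.idempotent K) where
  complete := completeOrthogonalIdempotents_idempotent
  primitive := isPrimitiveIdempotent_idempotent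
  basic _ _ h := isEmpty_linearEquiv_span_idempotent h

/-! ### The Cartan matrix -/

/-- The rank of a linear map which fixes some vectors of a basis and kills the others. -/
lemma _root_.LinearMap.finrank_range_eq_card {ι M : Type*} [Fintype ι] [AddCommGroup M]
    [Module K M] {v : ι → M} (hv : LinearIndependent K v)
    (hs : Submodule.span K (Set.range v) = ⊤) (f : M →ₗ[K] M) (s : ι → Prop)
    [DecidablePred s]
    (hf : ∀ i, f (v i) = if s i then v i else 0) :
    Module.finrank K (LinearMap.range f) = ∑ i, if s i then 1 else 0 := by
  have h : LinearMap.range f =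
      Submodule.span K (Set.range fun i : {i // s i} => v i) := by
    rw [← Submodule.map_top, ← hs, Submodule.map_span]
    refine le_antisymm (Submodule.span_le.2 ?_) (Submodule.span_mono ?_)
    · rintro _ ⟨_, ⟨i, rfl⟩, rfl⟩
      rw [hf]
      split_ifs with hi
      · exact Submodule.subset_span ⟨⟨i, hi⟩, rfl⟩
      · exact Submodule.zero_mem _
    · rintro _ ⟨⟨i, hi⟩, rfl⟩
      exact ⟨v i, ⟨i, rfl⟩, by rw [hf, if_pos hi]⟩
  rw [h, ← Finset.card_filter, ← Fintype.card_subtype]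
  exact finrank_span_eq_card (hv.comp _ Subtype.val_injective)

/-- The number of basis paths from `V` to `W` which are neither trivial nor socle elements. -/
def midCount (Γ : BrauerConfiguration Γ₀ Γ₁) (V W : Γ₁) : ℕ :=
  ∑ a : Γ.Arrow, ∑ k : Fin (a.socleLength - 1),
    if a.src = V ∧ (Arrow.next^[k + 1] a).src = W then 1 else 0

lemma cartanMatrix_eq (V W : Γ₁) :
    cartanMatrix K (Γ.idempotent K) V W = 2 * (if V = W then 1 else 0) + Γ.midCount W V := by
  classical
  have h : cartanMatrix K (Γ.idempotent K) V W =
      ∑ b : Γ.BasisIndex, if (basisPath (Γ := Γ) b).1 = W ∧ (basisPath (Γ := Γ) b).2.1 = V then 1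
        else 0 := by
    refine LinearMap.finrank_range_eq_card (linearIndependent_basisVector (K := K) (Γ := Γ))
      span_range_basisVector _ _ fun b => ?_
    refine Eq.trans ?_ (idempotent_mul_proj_mul W V (basisPath b))
    exact (mul_assoc (Γ.idempotent K W) (basisVector K b) (Γ.idempotent K V)).symm
  rw [h, Fintype.sum_sum_type, Fintype.sum_sum_type, Fintype.sum_sigma, ← add_assoc]
  congr 1
  · have h1 (U : Γ₁) : ((basisPath (Γ := Γ) (.inl U)).1 = W ∧
        (basisPath (Γ := Γ) (.inl U)).2.1 = V) ↔ (U = W ∧ U = V) := Iff.rfl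
    have h2 (U : Γ₁) : ((basisPath (Γ := Γ) (.inr (.inl U))).1 = W ∧
        (basisPath (Γ := Γ) (.inr (.inl U))).2.1 = V) ↔ (U = W ∧ U = V) := by
      have e1 : (basisPath (Γ := Γ) (.inr (.inl U))).1 = U := src_socleArrow U
      have e2 : (basisPath (Γ := Γ) (.inr (.inl U))).2.1 = U :=
        (snd_walkPath_socleLength _).trans (src_socleArrow U)
      exact and_congr (e1.congr_left) (e2.congr_left)
    have h3 : ∑ U : Γ₁, (if U = W ∧ U = V then 1 else 0) = if V = W then 1 else 0 := by
      rw [Finset.sum_eq_single W]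
      · simp [eq_comm]
      · intro U _ hU
        simp [hU]
      · simp
    simp only [h1, h2, h3]
    ring
  · exact Finset.sum_congr rfl fun a _ => Finset.sum_congr rfl fun k _ => by congr

open Classical in
/-- Adding to the basis paths between two quiver vertices the trivial beginnings of the walks gives
a sum over full turns around the cyclic orders. -/
lemma midCount_add (V W : Γ₁) :
    Γ.midCount V W + (if V = W then ∑ α ∈ Γ.support V,
      (if Γ.IsTruncated α then 0 else Γ.occ α V) else 0) =
    ∑ α ∈ Γ.support V, if Γ.IsTruncated α then 0 else Γ.occ α V * (Γ.mult α * Γ.occ α W) := by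
  have h0 : (if V = W then ∑ α ∈ Γ.support V, (if Γ.IsTruncated α then 0 else Γ.occ α V) else 0) =
      ∑ a : Γ.Arrow, if a.src = V then (if a.src = W then 1 else 0) else 0 := by
    have := sum_arrow_src (Γ := Γ) V fun _ => if V = W then 1 else 0
    trans ∑ a : Γ.Arrow, if a.src = V then (if V = W then 1 else 0) else 0
    · rw [this]
      split_ifs <;> simp
    · refine Finset.sum_congr rfl fun a _ => ?_
      split_ifs <;> simp_all
  rw [h0, ← sum_arrow_src V fun α => Γ.mult α * Γ.occ α W, midCount, ← Finset.sum_add_distrib]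
  refine Finset.sum_congr rfl fun a _ => ?_
  by_cases ha : a.src = V
  · rw [if_pos ha, if_pos ha, ← a.sum_range_socleLength W,
      ← Finset.sum_range fun k => if a.src = V ∧ (Arrow.next^[k + 1] a).src = W then 1 else 0]
    obtain ⟨n, hn⟩ : ∃ n, a.socleLength = n + 1 :=
      Nat.exists_eq_add_one_of_ne_zero (by have := a.one_lt_socleLength; omega)
    rw [hn, Finset.sum_range_succ', Nat.add_sub_cancel]
    simp only [ha, true_and, Function.iterate_zero, id_eq]
  · simp [ha]

lemma mem_support {α : Γ₀} {V : Γ₁} : α ∈ Γ.support V ↔ Γ.occ α V ≠ 0 := by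
  rw [support, Multiset.mem_toFinset, occ, Multiset.count_ne_zero]

/-- A truncated vertex occurs exactly once, in a single polygon. -/
lemma IsTruncated.occ_eq {α : Γ₀} (h : Γ.IsTruncated α) {V : Γ₁} (hV : α ∈ Γ.support V) (W : Γ₁) :
    Γ.occ α W = if W = V then 1 else 0 := by
  have h1 : Γ.occ α V + ∑ U ∈ Finset.univ.erase V, Γ.occ α U = 1 :=
    (Finset.add_sum_erase _ _ (Finset.mem_univ V)).trans h.1
  have h2 := mem_support.1 hV
  split_ifs with hW
  · subst hW; omega
  · have : Γ.occ α W ≤ ∑ U ∈ Finset.univ.erase V, Γ.occ α U :=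
      Finset.single_le_sum (fun _ _ => Nat.zero_le _) (Finset.mem_erase.2 ⟨hW, Finset.mem_univ W⟩)
    omega

lemma cartanMatrix_of_ne {V W : Γ₁} (h : V ≠ W) :
    cartanMatrix K (Γ.idempotent K) V W =
      ∑ α ∈ Γ.support V ∩ Γ.support W, Γ.mult α * Γ.occ α V * Γ.occ α W := by
  have hc := midCount_add (Γ := Γ) W V
  rw [if_neg h.symm, add_zero] at hc
  rw [cartanMatrix_eq, if_neg h, mul_zero, zero_add, hc, Finset.inter_comm]
  refine (Finset.sum_subset (s₁ := Γ.support W ∩ Γ.support V)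
    Finset.inter_subset_left fun α hW hV => ?_).symm.trans ?_
  · have : Γ.occ α V = 0 := by
      by_contra h0
      exact hV (Finset.mem_inter.2 ⟨hW, mem_support.2 h0⟩)
    simp [this]
  · refine Finset.sum_congr rfl fun α hα => ?_
    split_ifs with ht
    · rw [ht.occ_eq (Finset.mem_inter.1 hα).1 V, if_neg h, mul_zero, zero_mul]
    · ring

lemma cartanMatrix_self (V : Γ₁) :
    (cartanMatrix K (Γ.idempotent K) V V : ℤ) =
      2 + ∑ α ∈ Γ.support V, (Γ.occ α V : ℤ) * ((Γ.occ α V : ℤ) * (Γ.mult α : ℤ) - 1) := by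
  have hc := congrArg (Nat.cast : ℕ → ℤ) (midCount_add (Γ := Γ) V V)
  rw [if_pos rfl] at hc
  push_cast at hc
  rw [cartanMatrix_eq, if_pos rfl]
  push_cast
  rw [eq_sub_of_add_eq hc, ← Finset.sum_sub_distrib]
  congr 1
  refine Finset.sum_congr rfl fun α hα => ?_
  split_ifs with ht
  · simp [ht.occ_eq hα V, ht.2]
  · ring

end BrauerConfiguration

end

theorem proposition046 {K Γ₀ Γ₁ : Type*} [Field K] [Fintype Γ₀] [Fintype Γ₁]
    [DecidableEq Γ₀] [DecidableEq Γ₁] (Γ : BrauerConfiguration Γ₀ Γ₁) :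
    Module.Finite K (Γ.BrauerAlgebra K) ∧
    IsBasicIdempotentFamily (Γ.idempotent K) ∧
    (∀ V W : Γ₁, V ≠ W →
      cartanMatrix K (Γ.idempotent K) V W =
        ∑ α ∈ Γ.support V ∩ Γ.support W, Γ.mult α * Γ.occ α V * Γ.occ α W) ∧
    (∀ V : Γ₁,
      (cartanMatrix K (Γ.idempotent K) V V : ℤ) =
        2 + ∑ α ∈ Γ.support V, (Γ.occ α V : ℤ) * ((Γ.occ α V : ℤ) * (Γ.mult α : ℤ) - 1)) :=
  ⟨BrauerConfiguration.finite_brauerAlgebra, BrauerConfiguration.isBasicIdempotentFamily_idempotent,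
    fun _ _ h => BrauerConfiguration.cartanMatrix_of_ne h,
    fun V => BrauerConfiguration.cartanMatrix_self V⟩
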